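/- Let $I=[0,1]$, let $\mathcal{P}X$ be the space of paths $I\to X$ with the compact-open topology, and let $(\mathcal{P}X)_x\subseteq\mathcal{P}X$ be the subspace of paths starting at $x$. A path $\alpha\in\mathcal{P}X$ is *well-ended* (resp. *locally well-ended*) if for every open neighbourhood $U$ of $\alpha$ in $\mathcal{P}X$ there are open neighbourhoods $V_0,V_1$ of $\alpha(0),\alpha(1)$ in $X$ such that for all $a\in V_0$, $b\in V_1$ there is a path (resp. a well-ended path) $\beta\in U$ with $\beta(0)=a$ and $\beta(1)=b$. The space $X$ is *locally wep-connected* if every pair of points of $X$ can be joined by a locally well-ended path. Let $\Delta_2=\{(s,t)\in I^2: s+t\le 1\}$ and let $(\Phi X)_x$ be the space (compact-open topology) of maps $\Delta_2\to X$ that are constantly $x$ on the edge $s=0$. A *semicovering* of $X$ is a continuous map $p\colon Y\to X$ that is a local homeomorphism and such that for every $y\in Y$ the maps $(\mathcal{P}Y)_y\to(\mathcal{P}X)_{p(y)}$ and $(\Phi Y)_y\to(\Phi X)_{p(y)}$ given by composition with $p$ are homeomorphisms. Morphisms of semicoverings are continuous maps over $X$; this is the category $\mathbf{SCov}(X)$.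 Its full subcategory $\mathbf{SCov}_0(X)$ consists of the *connected* semicoverings, those with $Y$ non-empty and path connected. For a group $G$ with a topology, let $\tau(G)$ be the group $G$ with the quotient topology along the multiplication of letters $F_M(G)\to G$, where $F_M(G)$ is the free (Markov) topological group on the space $G$. Let $\pi_1^\tau(X,x_0)=\tau(\pi_1^{qtop}(X,x_0))$, where $\pi_1^{qtop}(X,x_0)$ is the fundamental group (with product $[\alpha][\beta]=[\alpha*\beta]$, first $\alpha$, then $\beta$) with the quotient topology from the loop space at $x_0$; it is a topological group. For a topological group $G$, a *right $G$-set* is a discrete space $F$ with a continuous right action of $G$; together with $G$-equivariant maps these form the category $G\mathbf{Set}$. A right $G$-set is *transitive* if $F=xG$ for some $x\in F$, and the *orbit category* $\mathscr{O}_G$ is the full subcategory of $G\mathbf{Set}$ on the transitive right $G$-sets. **Theorem.** Let $X$ be a locally wep-connected space, $x_0\in X$ and $G=\pi_1^\tau(X,x_0)$. 1. The functor $\mathbf{SCov}(X)\to G\mathbf{Set}$ taking a semicovering $p\colon Y\to X$ to the fibre $p^{-1}(x_0)$ with the action $(y,[\alpha])\mapsto y\cdot[\alpha]=\tilde\alpha_y(1)$,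 where $\tilde\alpha_y$ is the lift of $\alpha$ starting at $y$, and taking a morphism to its restriction to the fibres over $x_0$, is an equivalence of categories. 2. This functor takes connected semicoverings to transitive right $G$-sets, and it restricts to an equivalence of categories $\mathbf{SCov}_0(X)\to\mathscr{O}_G$. Moreover, a right $G$-set is transitive if and only if it is isomorphic to the discrete right coset space $H\backslash G$, with action $(Hg)\cdot k=H(gk)$, for some open subgroup $H$ of $G$. -/

import Mathlib

open CategoryTheory Topology

universe u

/-! ### Well-ended paths and locally wep-connected spaces -/

/-- A path `α` (a point of the path space `C(I, X)` with the compact-open topology) is well-ended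
if each of its neighbourhoods contains paths joining all pairs of points close to its endpoints. -/
def IsWellEnded {X : Type u} [TopologicalSpace X] (α : C(unitInterval, X)) : Prop :=
  ∀ U : Set C(unitInterval, X), IsOpen U → α ∈ U →
    ∃ V₀ V₁ : Set X, IsOpen V₀ ∧ IsOpen V₁ ∧ α 0 ∈ V₀ ∧ α 1 ∈ V₁ ∧
      ∀ a ∈ V₀, ∀ b ∈ V₁, ∃ β ∈ U, β 0 = a ∧ β 1 = b

/-- Locally well-ended paths: as before, but the connecting paths are themselves well-ended. -/
def IsLocallyWellEnded {X : Type u} [TopologicalSpace X] (α : C(unitInterval, X)) : Prop :=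
  ∀ U : Set C(unitInterval, X), IsOpen U → α ∈ U →
    ∃ V₀ V₁ : Set X, IsOpen V₀ ∧ IsOpen V₁ ∧ α 0 ∈ V₀ ∧ α 1 ∈ V₁ ∧
      ∀ a ∈ V₀, ∀ b ∈ V₁, ∃ β ∈ U, IsWellEnded β ∧ β 0 = a ∧ β 1 = b

/-- Every pair of points is joined by a locally well-ended path. -/
def IsLocallyWepConnected (X : Type u) [TopologicalSpace X] : Prop :=
  ∀ a b : X, ∃ α : C(unitInterval, X), IsLocallyWellEnded α ∧ α 0 = a ∧ α 1 = b

/-! ### Semicovering maps -/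

/-- The space of paths starting at `x`, a subspace of the path space (compact-open topology). -/
abbrev PathsFrom {X : Type u} [TopologicalSpace X] (x : X) : Type u :=
  {γ : C(unitInterval, X) // γ 0 = x}

/-- The map `γ ↦ p ∘ γ` from paths starting at `y` to paths starting at `p y`. -/
def PathsFrom.map {X Y : Type u} [TopologicalSpace X] [TopologicalSpace Y] (p : C(Y, X)) (y : Y)
    (γ : PathsFrom y) : PathsFrom (p y) :=
  ⟨p.comp γ.1, congrArg p γ.2⟩

/-- The 2-simplex `{(s, t) ∈ I² | s + t ≤ 1}`. -/
abbrev TriangleDomain : Type :=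
  {z : unitInterval × unitInterval // (z.1 : ℝ) + (z.2 : ℝ) ≤ 1}

/-- The space of maps from the 2-simplex to `X` which are constantly `x` on the edge `s = 0`
(the edge opposite to the vertex `(1, 0)`). Such a map is a homotopy, relative to the endpoints,
between the paths that it restricts to on the other two edges. -/
abbrev HomotopiesFrom {X : Type u} [TopologicalSpace X] (x : X) : Type u :=
  {φ : C(TriangleDomain, X) // ∀ z : TriangleDomain, z.1.1 = 0 → φ z = x}

/-- The map `φ ↦ p ∘ φ` on spaces of homotopies of paths. -/
def HomotopiesFrom.map {X Y : Type u} [TopologicalSpace X] [TopologicalSpace Y] (p : C(Y, X))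
    (y : Y) (φ : HomotopiesFrom y) : HomotopiesFrom (p y) :=
  ⟨p.comp φ.1, fun z hz => congrArg p (φ.2 z hz)⟩

/-- A semicovering map: a local homeomorphism with continuous lifting of paths and homotopies. -/
structure IsSemicovering {X Y : Type u} [TopologicalSpace X] [TopologicalSpace Y]
    (p : C(Y, X)) : Prop where
  isLocalHomeomorph : IsLocalHomeomorph p
  paths : ∀ y : Y, IsHomeomorph (PathsFrom.map p y)
  homotopies : ∀ y : Y, IsHomeomorph (HomotopiesFrom.map p y)

/-- A semicovering `p : Y → X` of `X`. -/
structure SCov (X : Type u) [TopologicalSpace X] where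
  space : Type u
  [topology : TopologicalSpace space]
  proj : C(space, X)
  isSemicovering : IsSemicovering proj

attribute [instance] SCov.topology

namespace SCov

/-- A morphism of semicoverings: a map over `X`. -/
@[ext]
structure Hom {X : Type u} [TopologicalSpace X] (p q : SCov X) where
  toMap : C(p.space, q.space)
  comm : ∀ y, q.proj (toMap y) = p.proj y

/-- The category of semicoverings of `X`. -/
instance category (X : Type u) [TopologicalSpace X] : Category (SCov X) where
  Hom p q := Hom p q
  id p := ⟨ContinuousMap.id _, fun _ => rfl⟩
  comp f g := ⟨g.toMap.comp f.toMap, fun y => (g.comm _).trans (f.comm y)⟩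

/-- A semicovering is connected if its total space is non-empty and path connected. -/
def isConnected (X : Type u) [TopologicalSpace X] : ObjectProperty (SCov X) :=
  fun p => PathConnectedSpace p.space

end SCov

/-- The full subcategory of connected semicoverings of `X`. -/
abbrev SCov₀ (X : Type u) [TopologicalSpace X] : Type (u + 1) :=
  (SCov.isConnected X).FullSubcategory

/-! ### The reflection `τ` of groups with topology into topological groups -/

/-- The free (Markov) topological group on a space `G`: the free group on the set `G` with the
finest group topology making the inclusion of generators continuous. -/
def markovTopology (G : Type u) (t : TopologicalSpace G) : GroupTopology (FreeGroup G) :=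
  @GroupTopology.coinduced G (FreeGroup G) t _ FreeGroup.of

/-- The topology of `τ(G)`: the quotient topology with respect to the multiplication of letters
`F_M(G) → G`. -/
def tauTopology (G : Type u) [Group G] (t : TopologicalSpace G) : TopologicalSpace G :=
  TopologicalSpace.coinduced (FreeGroup.lift (id : G → G)) (markovTopology G t).toTopologicalSpace

theorem isTopologicalGroup_tau (G : Type u) [Group G] (t : TopologicalSpace G) :
    @IsTopologicalGroup G (tauTopology G t) _ := by
  letI : TopologicalSpace (FreeGroup G) := (markovTopology G t).toTopologicalSpace
  haveI : IsTopologicalGroup (FreeGroup G) := (markovTopology G t).toIsTopologicalGroup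
  letI : TopologicalSpace G := tauTopology G t
  have hsurj : Function.Surjective (FreeGroup.lift (id : G → G)) := fun g =>
    ⟨FreeGroup.of g, by simp⟩
  have hq : IsQuotientMap (FreeGroup.lift (id : G → G)) := ⟨⟨rfl⟩, hsurj⟩
  have ho : IsOpenQuotientMap (FreeGroup.lift (id : G → G)) :=
    MonoidHom.isOpenQuotientMap_of_isQuotientMap hq
  have hc := hq.continuous
  refine { continuous_mul := ?_, continuous_inv := ?_ }
  · refine (ho.prodMap ho).isQuotientMap.continuous_iff.2 ?_
    have : (fun p : G × G => p.1 * p.2) ∘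
        Prod.map (FreeGroup.lift (id : G → G)) (FreeGroup.lift (id : G → G)) =
        fun p => FreeGroup.lift (id : G → G) (p.1 * p.2) := by
      funext p; simp
    rw [this]
    exact hc.comp continuous_mul
  · refine hq.continuous_iff.2 ?_
    have : (fun g : G => g⁻¹) ∘ FreeGroup.lift (id : G → G) =
        fun w => FreeGroup.lift (id : G → G) w⁻¹ := by
      funext p; simp
    rw [this]
    exact hc.comp continuous_inv

/-- Every group topology coarser than `t` is coarser than `τ`. -/
theorem tauTopology_le (G : Type u) [Group G] (t : TopologicalSpace G) (s : GroupTopology G)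
    (h : t ≤ s.toTopologicalSpace) : tauTopology G t ≤ s.toTopologicalSpace := by
  letI := s.toTopologicalSpace
  haveI := s.toIsTopologicalGroup
  rw [tauTopology, coinduced_le_iff_le_induced]
  let s' : GroupTopology (FreeGroup G) :=
    { toTopologicalSpace := TopologicalSpace.induced (FreeGroup.lift (id : G → G)) inferInstance
      toIsTopologicalGroup := topologicalGroup_induced _ }
  have : markovTopology G t ≤ s' := by
    refine sInf_le ?_
    show TopologicalSpace.coinduced FreeGroup.of t ≤ TopologicalSpace.induced _ _
    rw [coinduced_le_iff_le_induced, induced_compose]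
    have : (FreeGroup.lift (id : G → G)) ∘ FreeGroup.of = id := by funext g; simp
    rw [this, induced_id]
    exact h
  exact this

/-! ### The topological fundamental group -/

/-- The underlying set of the fundamental group: homotopy classes of loops at `x₀`. -/
def PiOne (X : Type u) [TopologicalSpace X] (x₀ : X) : Type u :=
  Path.Homotopic.Quotient x₀ x₀

namespace PiOne

/-- The canonical map from the loop space to the fundamental group. -/
def mk {X : Type u} [TopologicalSpace X] {x₀ : X} (γ : Path x₀ x₀) : PiOne X x₀ :=
  Path.Homotopic.Quotient.mk γ

/-- The group structure with `[α][β] = [α * β]` (first `α`, then `β`). -/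
noncomputable instance group (X : Type u) [TopologicalSpace X] (x₀ : X) : Group (PiOne X x₀) where
  mul a b := Path.Homotopic.Quotient.trans a b
  one := Path.Homotopic.Quotient.refl x₀
  inv a := Path.Homotopic.Quotient.symm a
  mul_assoc a b c := Category.assoc (X := FundamentalGroupoid.mk x₀)
    (Y := FundamentalGroupoid.mk x₀) (Z := FundamentalGroupoid.mk x₀)
    (W := FundamentalGroupoid.mk x₀) a b c
  one_mul a := Category.id_comp (X := FundamentalGroupoid.mk x₀)
    (Y := FundamentalGroupoid.mk x₀) a
  mul_one a := Category.comp_id (X := FundamentalGroupoid.mk x₀)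
    (Y := FundamentalGroupoid.mk x₀) a
  inv_mul_cancel a := Groupoid.inv_comp (X := FundamentalGroupoid.mk x₀)
    (Y := FundamentalGroupoid.mk x₀) a

/-- The topology of the quasitopological fundamental group: the quotient topology with respect to
the canonical map from the loop space (compact-open topology) to homotopy classes. -/
def qtop (X : Type u) [TopologicalSpace X] (x₀ : X) : TopologicalSpace (PiOne X x₀) :=
  TopologicalSpace.coinduced (PiOne.mk : Path x₀ x₀ → PiOne X x₀) inferInstance

/-- The fundamental group is topologized as `τ` of the quasitopological fundamental group. -/
noncomputable instance topologicalSpace (X : Type u) [TopologicalSpace X] (x₀ : X) :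
    TopologicalSpace (PiOne X x₀) :=
  tauTopology (PiOne X x₀) (qtop X x₀)

instance isTopologicalGroup (X : Type u) [TopologicalSpace X] (x₀ : X) :
    IsTopologicalGroup (PiOne X x₀) :=
  isTopologicalGroup_tau _ _

end PiOne

/-! ### Right `G`-sets -/

/-- A right `G`-set: a set, viewed as a discrete space, with a continuous right action of `G`. -/
structure RightGSet (G : Type u) [Group G] [TopologicalSpace G] where
  carrier : Type u
  act : carrier → G → carrier
  act_one : ∀ y, act y 1 = y
  act_mul : ∀ y g h, act y (g * h) = act (act y g) h
  continuous_act : letI : TopologicalSpace carrier := ⊥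
    Continuous fun z : carrier × G => act z.1 z.2

namespace RightGSet

/-- A `G`-map of right `G`-sets. -/
@[ext]
structure Hom {G : Type u} [Group G] [TopologicalSpace G] (F F' : RightGSet G) where
  toFun : F.carrier → F'.carrier
  map_act : ∀ y g, toFun (F.act y g) = F'.act (toFun y) g

/-- The category of right `G`-sets and `G`-maps. -/
instance category (G : Type u) [Group G] [TopologicalSpace G] : Category (RightGSet G) where
  Hom F F' := Hom F F'
  id F := ⟨id, fun _ _ => rfl⟩
  comp f g := ⟨g.toFun ∘ f.toFun, fun y k => by simp [f.map_act, g.map_act]⟩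

/-- `F` is transitive if `F = xG` for some `x ∈ F`; in particular `F` is non-empty. -/
def isTransitive (G : Type u) [Group G] [TopologicalSpace G] : ObjectProperty (RightGSet G) :=
  fun F => ∃ x : F.carrier, ∀ y : F.carrier, ∃ g : G, F.act x g = y

theorem continuous_act_of_isOpen {G F : Type u} [TopologicalSpace G] (act : F → G → F)
    (h : ∀ y z, IsOpen {g : G | act y g = z}) : letI : TopologicalSpace F := ⊥
    Continuous fun z : F × G => act z.1 z.2 := by
  letI : TopologicalSpace F := ⊥
  haveI : DiscreteTopology F := ⟨rfl⟩
  rw [continuous_prod_of_discrete_left]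
  intro y
  rw [continuous_discrete_rng]
  exact fun z => h y z

/-- The right action `(Hg) · k = H(gk)` of `G` on right cosets of `H`. -/
def cosetAct {G : Type u} [Group G] (H : Subgroup G) (y : Quotient (QuotientGroup.rightRel H))
    (k : G) : Quotient (QuotientGroup.rightRel H) :=
  Quotient.map' (· * k) (fun a b hab => by
    rw [QuotientGroup.rightRel_apply] at hab ⊢
    simpa [mul_assoc] using hab) y

/-- For an open subgroup `H` of a topological group `G`, the discrete right coset space `H\G`
with the right action `(Hg) · k = H(gk)`. -/
def coset {G : Type u} [Group G] [TopologicalSpace G] [IsTopologicalGroup G] (H : OpenSubgroup G) :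
    RightGSet G where
  carrier := Quotient (QuotientGroup.rightRel (H : Subgroup G))
  act y k := cosetAct (H : Subgroup G) y k
  act_one y := by
    induction y using Quotient.inductionOn'
    simp [cosetAct]
  act_mul y g h := by
    induction y using Quotient.inductionOn'
    simp [cosetAct, mul_assoc]
  continuous_act := by
    refine continuous_act_of_isOpen _ fun y z => ?_
    induction y using Quotient.inductionOn' with | _ a =>
    induction z using Quotient.inductionOn' with | _ b =>
    have : {g : G | cosetAct (H : Subgroup G) (Quotient.mk'' a) g = Quotient.mk'' b} =
        (fun g : G => b * (a * g)⁻¹) ⁻¹' (H : Set G) := by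
      ext g
      rw [Set.mem_setOf_eq, cosetAct, Quotient.map'_mk'', Quotient.eq'',
        QuotientGroup.rightRel_apply]
      rfl
    rw [this]
    exact H.isOpen.preimage (by fun_prop)

end RightGSet

/-- The orbit category of `G`: the full subcategory of transitive right `G`-sets. -/
abbrev OrbitCategory (G : Type u) [Group G] [TopologicalSpace G] : Type (u + 1) :=
  (RightGSet.isTransitive G).FullSubcategory

/-! ### The monodromy action on the fibres of a semicovering -/

namespace IsSemicovering

variable {X Y : Type u} [TopologicalSpace X] [TopologicalSpace Y] {p : C(Y, X)}

/-- The lift, starting at `y`, of a path starting at `p y`. -/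
noncomputable def lift (hp : IsSemicovering p) (y : Y) (γ : PathsFrom (p y)) : PathsFrom y :=
  (hp.paths y).homeomorph.symm γ

theorem continuous_lift (hp : IsSemicovering p) (y : Y) : Continuous (hp.lift y) :=
  (hp.paths y).homeomorph.symm.continuous

theorem comp_lift (hp : IsSemicovering p) (y : Y) (γ : PathsFrom (p y)) :
    p.comp (hp.lift y γ).1 = γ.1 :=
  congrArg Subtype.val ((hp.paths y).homeomorph.apply_symm_apply γ)

theorem eq_of_comp_eq (hp : IsSemicovering p) {δ δ' : C(unitInterval, Y)} (h0 : δ 0 = δ' 0)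
    (h : p.comp δ = p.comp δ') : δ = δ' := by
  have := (hp.paths (δ' 0)).injective (a₁ := ⟨δ, h0⟩) (a₂ := ⟨δ', rfl⟩) (Subtype.ext h)
  exact congrArg Subtype.val this

/-- The lift, starting at a point `y` of the fibre over `x₀`, of a path from `x₀` to `x₁`. -/
noncomputable def liftPath (hp : IsSemicovering p) {x₀ x₁ : X} (y : p ⁻¹' {x₀})
    (γ : Path x₀ x₁) : C(unitInterval, Y) :=
  (hp.lift y.1 ⟨γ.toContinuousMap, γ.source.trans y.2.symm⟩).1

theorem liftPath_zero (hp : IsSemicovering p) {x₀ x₁ : X} (y : p ⁻¹' {x₀}) (γ : Path x₀ x₁) :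
    hp.liftPath y γ 0 = y.1 :=
  (hp.lift y.1 _).2

theorem proj_liftPath (hp : IsSemicovering p) {x₀ x₁ : X} (y : p ⁻¹' {x₀}) (γ : Path x₀ x₁)
    (t : unitInterval) : p (hp.liftPath y γ t) = γ t :=
  DFunLike.congr_fun (hp.comp_lift y.1 _) t

theorem proj_liftPath_one (hp : IsSemicovering p) {x₀ x₁ : X} (y : p ⁻¹' {x₀})
    (γ : Path x₀ x₁) : p (hp.liftPath y γ 1) = x₁ :=
  (hp.proj_liftPath y γ 1).trans γ.target

theorem liftPath_eq (hp : IsSemicovering p) {x₀ x₁ : X} (y : p ⁻¹' {x₀}) (γ : Path x₀ x₁)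
    {δ : C(unitInterval, Y)} (h0 : δ 0 = y.1) (h : ∀ t, p (δ t) = γ t) :
    hp.liftPath y γ = δ :=
  hp.eq_of_comp_eq ((hp.liftPath_zero y γ).trans h0.symm)
    (ContinuousMap.ext fun t => (hp.proj_liftPath y γ t).trans (h t).symm)

theorem continuous_liftPath_one (hp : IsSemicovering p) {x₀ x₁ : X} (y : p ⁻¹' {x₀}) :
    Continuous fun γ : Path x₀ x₁ => hp.liftPath y γ 1 := by
  have h1 : Continuous fun γ : Path x₀ x₁ =>
      (⟨γ.toContinuousMap, γ.source.trans y.2.symm⟩ : PathsFrom (p y.1)) :=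
    Continuous.subtype_mk continuous_induced_dom _
  exact (continuous_eval_const (1 : unitInterval)).comp
    (continuous_subtype_val.comp ((hp.continuous_lift y.1).comp h1))

theorem liftPath_one_eq_of_homotopic (hp : IsSemicovering p) {x₀ x₁ : X} (y : p ⁻¹' {x₀})
    {γ γ' : Path x₀ x₁} (h : γ.Homotopic γ') : hp.liftPath y γ 1 = hp.liftPath y γ' 1 := by
  obtain ⟨H⟩ := h
  have hc : Continuous fun t => H.eval t := by
    refine continuous_induced_rng.2 ?_
    exact (H.toHomotopy.toContinuousMap.curry).continuous
  let c : C(unitInterval, Y) :=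
    ⟨fun t => hp.liftPath y (H.eval t) 1, (hp.continuous_liftPath_one y).comp hc⟩
  have hcc : c = ContinuousMap.const _ (c 0) := by
    refine hp.eq_of_comp_eq rfl (ContinuousMap.ext fun t => ?_)
    show p (hp.liftPath y (H.eval t) 1) = p (hp.liftPath y (H.eval 0) 1)
    rw [hp.proj_liftPath_one, hp.proj_liftPath_one]
  have h01 : c 0 = c 1 := by rw [hcc]; rfl
  have : hp.liftPath y (H.eval 0) 1 = hp.liftPath y (H.eval 1) 1 := h01
  rwa [H.eval_zero, H.eval_one] at this

/-- The monodromy action `(y, [α]) ↦ y · [α]`, the endpoint of the lift of `α` starting at `y`. -/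
noncomputable def monodromy (hp : IsSemicovering p) {x₀ x₁ : X} (y : p ⁻¹' {x₀})
    (a : Path.Homotopic.Quotient x₀ x₁) : p ⁻¹' {x₁} :=
  Quotient.lift (s := Path.Homotopic.setoid x₀ x₁)
    (fun γ => (⟨hp.liftPath y γ 1, hp.proj_liftPath_one y γ⟩ : p ⁻¹' {x₁}))
    (fun _ _ h => Subtype.ext (hp.liftPath_one_eq_of_homotopic y h)) a

theorem monodromy_mk (hp : IsSemicovering p) {x₀ x₁ : X} (y : p ⁻¹' {x₀}) (γ : Path x₀ x₁) :
    (hp.monodromy y (Path.Homotopic.Quotient.mk γ)).1 = hp.liftPath y γ 1 :=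
  rfl

theorem monodromy_refl (hp : IsSemicovering p) {x₀ : X} (y : p ⁻¹' {x₀}) :
    hp.monodromy y (Path.Homotopic.Quotient.refl x₀) = y := by
  refine Subtype.ext ?_
  rw [← Path.Homotopic.Quotient.mk_refl, monodromy_mk,
    hp.liftPath_eq y (Path.refl x₀) (δ := ContinuousMap.const _ y.1) rfl fun _ => y.2]
  rfl

theorem monodromy_trans (hp : IsSemicovering p) {x₀ x₁ x₂ : X} (y : p ⁻¹' {x₀})
    (a : Path.Homotopic.Quotient x₀ x₁) (b : Path.Homotopic.Quotient x₁ x₂) :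
    hp.monodromy y (a.trans b) = hp.monodromy (hp.monodromy y a) b := by
  induction a using Path.Homotopic.Quotient.ind with | _ α =>
  induction b using Path.Homotopic.Quotient.ind with | _ β =>
  refine Subtype.ext ?_
  set z := hp.monodromy y (Path.Homotopic.Quotient.mk α) with hz
  rw [← Path.Homotopic.Quotient.mk_trans, monodromy_mk, monodromy_mk]
  let δ₁ : Path y.1 z.1 := ⟨hp.liftPath y α, hp.liftPath_zero y α, rfl⟩
  let δ₂ : Path z.1 (hp.liftPath z β 1) := ⟨hp.liftPath z β, hp.liftPath_zero z β, rfl⟩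
  rw [hp.liftPath_eq y (α.trans β) (δ := (δ₁.trans δ₂).toContinuousMap) (δ₁.trans δ₂).source]
  · exact (δ₁.trans δ₂).target
  · intro t
    show p ((δ₁.trans δ₂) t) = (α.trans β) t
    rw [Path.trans_apply, Path.trans_apply]
    split_ifs
    · exact hp.proj_liftPath y α _
    · exact hp.proj_liftPath z β _

/-- The monodromy action on a fibre is continuous for the topology of `PiOne`. -/
theorem isOpen_monodromy (hp : IsSemicovering p) {x₀ : X} (y z : p ⁻¹' {x₀}) :
    IsOpen {g : PiOne X x₀ | hp.monodromy y g = z} := by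
  letI : TopologicalSpace (p ⁻¹' {x₀}) := ⊥
  haveI : DiscreteTopology (p ⁻¹' {x₀}) := ⟨rfl⟩
  let f : PiOne X x₀ → (p ⁻¹' {x₀}) → (p ⁻¹' {x₀}) := fun g w => hp.monodromy w g
  have hf : ∀ w v, IsOpen[TopologicalSpace.induced f inferInstance] {g | f g w = v} := fun w v =>
    ⟨(fun k => k w) ⁻¹' {v}, (isOpen_discrete _).preimage (continuous_apply w), rfl⟩
  let s : GroupTopology (PiOne X x₀) :=
    { toTopologicalSpace := TopologicalSpace.induced f inferInstance
      continuous_mul := by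
        letI : TopologicalSpace (PiOne X x₀) := TopologicalSpace.induced f inferInstance
        refine continuous_induced_rng.2 (continuous_pi fun w => ?_)
        rw [continuous_discrete_rng]
        intro v
        rw [isOpen_iff_forall_mem_open]
        rintro ⟨g, h⟩ hgh
        refine ⟨{g' | f g' w = f g w} ×ˢ {h' | f h' (f g w) = f h (f g w)}, ?_,
          (hf _ _).prod (hf _ _), rfl, rfl⟩
        rintro ⟨g', h'⟩ ⟨hg', hh'⟩
        have e1 : f (g' * h') w = f h' (f g' w) := hp.monodromy_trans w g' h'
        have e2 : f (g * h) w = f h (f g w) := hp.monodromy_trans w g h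
        show f (g' * h') w = v
        have hv : f (g * h) w = v := hgh
        rw [e1, show f g' w = f g w from hg', show f h' (f g w) = f h (f g w) from hh', ← e2, hv]
      continuous_inv := by
        letI : TopologicalSpace (PiOne X x₀) := TopologicalSpace.induced f inferInstance
        refine continuous_induced_rng.2 (continuous_pi fun w => ?_)
        rw [continuous_discrete_rng]
        intro v
        have : ((fun g : PiOne X x₀ => (f ∘ fun a => a⁻¹) g w) ⁻¹' {v}) = {g | f g v = w} := by
          ext g
          show f g⁻¹ w = v ↔ f g v = w
          constructor
          · rintro rfl
            have e : f (g⁻¹ * g) w = f g (f g⁻¹ w) := hp.monodromy_trans w (g⁻¹ : PiOne X x₀) g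
            rw [← e, inv_mul_cancel]
            exact hp.monodromy_refl w
          · rintro rfl
            have e : f (g * g⁻¹) v = f g⁻¹ (f g v) := hp.monodromy_trans v g (g⁻¹ : PiOne X x₀)
            rw [← e, mul_inv_cancel]
            exact hp.monodromy_refl v
        rw [this]
        exact hf v w }
  have hs : PiOne.qtop X x₀ ≤ s.toTopologicalSpace := by
    rw [PiOne.qtop, ← continuous_iff_coinduced_le]
    refine continuous_induced_rng.2 (continuous_pi fun w => ?_)
    rw [continuous_discrete_rng]
    intro v
    obtain ⟨U, hU, hinj⟩ := hp.isLocalHomeomorph.isLocallyInjective v.1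
    have : ((fun γ : Path x₀ x₀ => (f ∘ PiOne.mk) γ w) ⁻¹' {v}) =
        (fun γ : Path x₀ x₀ => hp.liftPath w γ 1) ⁻¹' U := by
      ext γ
      show hp.monodromy w (Path.Homotopic.Quotient.mk γ) = v ↔ hp.liftPath w γ 1 ∈ U
      rw [Subtype.ext_iff, monodromy_mk]
      constructor
      · intro h
        rw [h]
        exact hinj.1
      · intro h
        refine hinj.2 h hinj.1 ?_
        rw [hp.proj_liftPath_one]
        exact v.2.symm
    rw [this]
    exact hU.preimage (hp.continuous_liftPath_one w)
  exact tauTopology_le _ _ s hs _ (hf y z)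

end IsSemicovering

/-- The fibre of a semicovering over `x₀`, as a right `π₁(X, x₀)`-set under monodromy. -/
noncomputable def SCov.fibre {X : Type u} [TopologicalSpace X] (x₀ : X) (p : SCov X) :
    RightGSet (PiOne X x₀) where
  carrier := p.proj ⁻¹' {x₀}
  act y g := p.isSemicovering.monodromy y g
  act_one y := p.isSemicovering.monodromy_refl y
  act_mul y g h := p.isSemicovering.monodromy_trans y g h
  continuous_act :=
    RightGSet.continuous_act_of_isOpen _ fun y z => p.isSemicovering.isOpen_monodromy y z

/-- The functor taking a semicovering to its fibre over `x₀`, and a morphism of semicoverings to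
its restriction to the fibres over `x₀`. -/
noncomputable def fibreFunctor {X : Type u} [TopologicalSpace X] (x₀ : X) :
    SCov X ⥤ RightGSet (PiOne X x₀) where
  obj p := p.fibre x₀
  map {p q} f :=
    { toFun := fun y => ⟨f.toMap y.1, (f.comm y.1).trans y.2⟩
      map_act := fun y g => by
        induction g using Path.Homotopic.Quotient.ind with | _ γ =>
        refine Subtype.ext ?_
        show f.toMap (p.isSemicovering.liftPath y γ 1) = q.isSemicovering.liftPath _ γ 1
        rw [q.isSemicovering.liftPath_eq _ γ
          (δ := f.toMap.comp (p.isSemicovering.liftPath y γ))]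
        · rfl
        · exact congrArg f.toMap (p.isSemicovering.liftPath_zero y γ)
        · exact fun t => (f.comm _).trans (p.isSemicovering.proj_liftPath y γ t) }

/-! ### Paths starting at a point -/

/-! Full faithfulness: every point of a semicovering has the form `w · a`, with `w` in the fibre
over `x₀` and `a` the class of a path from `x₀`. A morphism satisfies `f (w · a) = f w · a`, so its
values on the fibre determine it, and an equivariant map of fibres extends by this formula. The
extension is continuous since endpoints of lifts depend continuously on the path, while well-ended
paths reach all nearby points by nearby paths (`continuous_extend`).

Essential surjectivity: a right `π₁`-set `F` gives `Total F`, the classes `[z, γ]` with `[z, α] = [z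
· [α * β⁻¹], β]`, projected to the endpoint of `γ`. As `τ` is coarser than the quotient topology, `z
· [γ] = z'` is an open condition on loops `γ`, so equal classes stay equal when both paths move
slightly with a common endpoint (`exists_isOpen_of_mk_eq`). Hence `[z, β]` depends only on `β(1)`
for `β` near a given path. Locally well-ended paths turn this into open sheets (`isOpen_section`),
making the projection a separated local homeomorphism. Paths and homotopies lift continuously by
appending to a representing path the tracks of a contraction of the domain
(`exists_continuous_lift`); separatedness gives uniqueness.

For connected semicoverings, path components of the total space correspond to orbits in the fibre
(`isTransitive_fibre_iff`). -/

namespace PathsFrom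

variable {X : Type u} [TopologicalSpace X] {x₀ : X}

/-- A path starting at `x₀` as a `Path` to its endpoint. -/
def toPath (γ : PathsFrom x₀) : Path x₀ (γ.1 1) := ⟨γ.1, γ.2, rfl⟩

/-- A `Path` from `x₀`, as a path starting at `x₀`. -/
def ofPath {x : X} (γ : Path x₀ x) : PathsFrom x₀ := ⟨γ.toContinuousMap, γ.source⟩

theorem ofPath_one {x : X} (γ : Path x₀ x) : (ofPath γ).1 1 = x := γ.target

/-- Paths whose endpoints are only provably equal become `Path`s with literally the same endpoint,
so that groupoid identities apply without casts. -/
theorem exists_ofPath {γ : PathsFrom x₀} {x : X} (h : γ.1 1 = x) : ∃ α : Path x₀ x, γ = ofPath α :=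
  ⟨⟨γ.1, γ.2, h⟩, rfl⟩

theorem exists_ofPath' (γ : PathsFrom x₀) : ∃ (x : X) (α : Path x₀ x), γ = ofPath α :=
  ⟨_, γ.toPath, rfl⟩

theorem continuous_ofPath {ι : Type*} [TopologicalSpace ι] {x : ι → X} (γ : ∀ i, Path x₀ (x i))
    (h : Continuous ↿γ) : Continuous fun i => ofPath (γ i) :=
  Continuous.subtype_mk
    (ContinuousMap.continuous_of_continuous_uncurry (fun i => (γ i).toContinuousMap) h) _

theorem continuous_uncurry_toPath :
    Continuous ↿(fun γ : PathsFrom x₀ => γ.toPath) := by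
  change Continuous fun q : PathsFrom x₀ × unitInterval => q.1.1 q.2
  fun_prop

/-- The loop `γ * γ'⁻¹` for paths with a common endpoint. -/
noncomputable def loop (γ γ' : PathsFrom x₀) (h : γ.1 1 = γ'.1 1) : Path x₀ x₀ :=
  γ.toPath.trans (γ'.toPath.cast rfl h).symm

theorem loop_ofPath {x : X} (α β : Path x₀ x) (h : (ofPath α).1 1 = (ofPath β).1 1) :
    PiOne.mk (loop (ofPath α) (ofPath β) h) =
      (Path.Homotopic.Quotient.mk α).trans (Path.Homotopic.Quotient.mk β).symm := by
  rw [← Path.Homotopic.Quotient.mk_symm, ← Path.Homotopic.Quotient.mk_trans]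
  have : loop (ofPath α) (ofPath β) h = α.trans β.symm := by
    ext t
    simp only [loop, Path.trans_apply]
    split_ifs <;> rfl
  rw [this]
  rfl

/-- Used to turn open sets of loops into open conditions on pairs of paths with a common endpoint.
-/
theorem continuous_loop :
    Continuous fun q : {q : PathsFrom x₀ × PathsFrom x₀ // q.1.1 1 = q.2.1 1} =>
      loop q.1.1 q.1.2 q.2 := by
  rw [← Path.continuous_uncurry_iff]
  refine Path.trans_continuous_family
    (ι := {q : PathsFrom x₀ × PathsFrom x₀ // q.1.1 1 = q.2.1 1}) (fun q => q.1.1.toPath) ?_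
    (fun q => (q.1.2.toPath.cast rfl q.2).symm) ?_
  · exact continuous_uncurry_toPath.comp
      ((continuous_fst.comp (continuous_subtype_val.comp continuous_fst)).prodMk continuous_snd)
  · refine Path.symm_continuous_family
      (ι := {q : PathsFrom x₀ × PathsFrom x₀ // q.1.1 1 = q.2.1 1})
      (fun q => q.1.2.toPath.cast rfl q.2) ?_
    exact continuous_uncurry_toPath.comp
      ((continuous_snd.comp (continuous_subtype_val.comp continuous_fst)).prodMk continuous_snd)

end PathsFrom

/-! ### Well-ended paths with fixed starting point -/

section WellEnded

variable {X : Type u} [TopologicalSpace X] {x₀ : X}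

theorem IsWellEnded.exists_isOpen {γ : PathsFrom x₀} (hγ : IsWellEnded γ.1)
    {U : Set (PathsFrom x₀)} (hU : IsOpen U) (hm : γ ∈ U) :
    ∃ V : Set X, IsOpen V ∧ γ.1 1 ∈ V ∧ ∀ b ∈ V, ∃ β ∈ U, β.1 1 = b := by
  obtain ⟨W, hW, rfl⟩ := isOpen_induced_iff.1 hU
  obtain ⟨V₀, V₁, -, h₁, hm₀, hm₁, h⟩ := hγ W hW hm
  refine ⟨V₁, h₁, hm₁, fun b hb => ?_⟩
  obtain ⟨β, hβ, h0, h1⟩ := h x₀ (γ.2 ▸ hm₀) b hb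
  exact ⟨⟨β, h0⟩, hβ, h1⟩

theorem IsLocallyWellEnded.exists_isOpen {γ : PathsFrom x₀} (hγ : IsLocallyWellEnded γ.1)
    {U : Set (PathsFrom x₀)} (hU : IsOpen U) (hm : γ ∈ U) :
    ∃ V : Set X, IsOpen V ∧ γ.1 1 ∈ V ∧ ∀ b ∈ V, ∃ β ∈ U, IsWellEnded β.1 ∧ β.1 1 = b := by
  obtain ⟨W, hW, rfl⟩ := isOpen_induced_iff.1 hU
  obtain ⟨V₀, V₁, -, h₁, hm₀, hm₁, h⟩ := hγ W hW hm
  refine ⟨V₁, h₁, hm₁, fun b hb => ?_⟩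
  obtain ⟨β, hβ, hw, h0, h1⟩ := h x₀ (γ.2 ▸ hm₀) b hb
  exact ⟨⟨β, h0⟩, hβ, hw, h1⟩

theorem IsLocallyWellEnded.isWellEnded {α : C(unitInterval, X)} (h : IsLocallyWellEnded α) :
    IsWellEnded α := fun U hU hα => by
  obtain ⟨V₀, V₁, h₀, h₁, hm₀, hm₁, H⟩ := h U hU hα
  refine ⟨V₀, V₁, h₀, h₁, hm₀, hm₁, fun a ha b hb => ?_⟩
  obtain ⟨β, hβ, -, h⟩ := H a ha b hb
  exact ⟨β, hβ, h⟩

theorem IsLocallyWepConnected.exists_path (hX : IsLocallyWepConnected X) (a b : X) :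
    ∃ α : Path a b, IsLocallyWellEnded α.toContinuousMap := by
  obtain ⟨α, h, h0, h1⟩ := hX a b
  exact ⟨⟨α, h0, h1⟩, h⟩

end WellEnded

/-! ### Monodromy determines morphisms of semicoverings -/

namespace IsSemicovering

variable {X Y Z : Type u} [TopologicalSpace X] [TopologicalSpace Y] [TopologicalSpace Z]
  {p : C(Y, X)} {q : C(Z, X)}

theorem monodromy_symm_trans (hp : IsSemicovering p) {x₀ x₁ : X} (y : p ⁻¹' {x₁})
    (a : Path.Homotopic.Quotient x₀ x₁) : hp.monodromy (hp.monodromy y a.symm) a = y := by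
  rw [← monodromy_trans, Path.Homotopic.Quotient.symm_trans, monodromy_refl]

theorem map_monodromy (hp : IsSemicovering p) (hq : IsSemicovering q) (f : C(Y, Z))
    (hf : ∀ y, q (f y) = p y) {x₀ x₁ : X} (y : p ⁻¹' {x₀}) (a : Path.Homotopic.Quotient x₀ x₁) :
    f (hp.monodromy y a).1 = (hq.monodromy ⟨f y.1, (hf y.1).trans y.2⟩ a).1 := by
  induction a using Path.Homotopic.Quotient.ind with | _ γ =>
  rw [monodromy_mk, monodromy_mk, hq.liftPath_eq _ γ (δ := f.comp (hp.liftPath y γ))]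
  · rfl
  · exact congrArg f (hp.liftPath_zero y γ)
  · exact fun t => (hf _).trans (hp.proj_liftPath y γ t)

/-- Path lifting is the inverse of a homeomorphism, and evaluation at `1` is continuous. -/
theorem continuous_monodromy_ofPath (hp : IsSemicovering p) {x₀ : X} (y : p ⁻¹' {x₀}) :
    Continuous fun γ : PathsFrom x₀ => (hp.monodromy y (.mk γ.toPath)).1 := by
  have h1 : Continuous fun γ : PathsFrom x₀ =>
      (⟨γ.1, γ.2.trans y.2.symm⟩ : PathsFrom (p y.1)) :=
    Continuous.subtype_mk continuous_subtype_val _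
  exact (continuous_eval_const (1 : unitInterval)).comp
    (continuous_subtype_val.comp ((hp.continuous_lift y.1).comp h1))

/-- The lift of a path in the total space is that path. -/
theorem monodromy_map (hp : IsSemicovering p) {a b : Y} (δ : Path a b) {x₀ x₁ : X}
    (h₀ : x₀ = p a) (h₁ : x₁ = p b) :
    (hp.monodromy ⟨a, h₀.symm⟩ (.mk ((δ.map p.continuous).cast h₀ h₁))).1 = b := by
  rw [monodromy_mk, hp.liftPath_eq _ _ (δ := δ.toContinuousMap) δ.source fun _ => rfl]
  exact δ.target

variable {x₀ : X}

/-- The extension of an equivariant map between the fibres over `x₀` to the total spaces. -/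
noncomputable def extend (hX : IsLocallyWepConnected X) (hp : IsSemicovering p)
    (hq : IsSemicovering q) (f : p ⁻¹' {x₀} → q ⁻¹' {x₀}) (y : Y) : Z :=
  let a := Path.Homotopic.Quotient.mk (hX.exists_path x₀ (p y)).choose
  (hq.monodromy (f (hp.monodromy ⟨y, rfl⟩ a.symm)) a).1

variable (hX : IsLocallyWepConnected X) (hp : IsSemicovering p) (hq : IsSemicovering q)
  (f : p ⁻¹' {x₀} → q ⁻¹' {x₀})

theorem proj_extend (y : Y) : q (hp.extend hX hq f y) = p y :=
  (hq.monodromy (f (hp.monodromy ⟨y, rfl⟩ _)) _).2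

theorem extend_monodromy
    (hf : ∀ y (g : Path.Homotopic.Quotient x₀ x₀), f (hp.monodromy y g) = hq.monodromy (f y) g)
    (w : p ⁻¹' {x₀}) {x : X} (a : Path.Homotopic.Quotient x₀ x) :
    hp.extend hX hq f (hp.monodromy w a).1 = (hq.monodromy (f w) a).1 := by
  -- Naming the point allows `x` to be replaced by `p y`, so that `a` and the path chosen in
  -- `extend` share their endpoint.
  obtain ⟨y, hy⟩ : ∃ y, y = hp.monodromy w a := ⟨_, rfl⟩
  rw [← hy]
  obtain ⟨y, rfl⟩ := y
  change (hq.monodromy (f (hp.monodromy ⟨y, rfl⟩ _)) _).1 = _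
  generalize Path.Homotopic.Quotient.mk (hX.exists_path x₀ (p y)).choose = b
  have e : hp.monodromy (⟨y, rfl⟩ : p ⁻¹' {p y}) b.symm = hp.monodromy w (a.trans b.symm) :=
    (congrArg (fun v => hp.monodromy v b.symm) hy).trans (hp.monodromy_trans w a b.symm).symm
  rw [e, hf, ← hq.monodromy_trans, Path.Homotopic.Quotient.trans_assoc,
    Path.Homotopic.Quotient.symm_trans, Path.Homotopic.Quotient.trans_refl]

theorem continuous_extend
    (hf : ∀ y (g : Path.Homotopic.Quotient x₀ x₀), f (hp.monodromy y g) = hq.monodromy (f y) g) :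
    Continuous (hp.extend hX hq f) := by
  rw [continuous_iff_continuousAt]
  intro y
  obtain ⟨α, hα⟩ := hX.exists_path x₀ (p y)
  set a := Path.Homotopic.Quotient.mk α
  obtain ⟨w, hw⟩ : ∃ w, hp.monodromy w a = (⟨y, rfl⟩ : p ⁻¹' {p y}) :=
    ⟨_, hp.monodromy_symm_trans _ a⟩
  have hmk : ∀ β : PathsFrom x₀, hp.extend hX hq f (hp.monodromy w (.mk β.toPath)).1 =
      (hq.monodromy (f w) (.mk β.toPath)).1 := fun β => hp.extend_monodromy hX hq f hf w _
  rw [ContinuousAt, (nhds_basis_opens _).tendsto_right_iff]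
  rintro W ⟨hyW, hW⟩
  obtain ⟨V, hV, hyV, hinj⟩ := hp.isLocalHomeomorph.isLocallyInjective y
  have hαw : (hp.monodromy w (.mk α)).1 = y := congrArg Subtype.val hw
  have hfw : hp.extend hX hq f y = (hq.monodromy (f w) (.mk α)).1 := by
    rw [← hp.extend_monodromy hX hq f hf w, hαw]
  -- Every point of `N` is the end of a path whose lift from `w` ends in `V` and whose lift from `f
  -- w` ends in `W`.
  obtain ⟨N, hN, hyN, h⟩ := IsWellEnded.exists_isOpen (γ := PathsFrom.ofPath α) hα.isWellEnded
    ((hV.preimage (hp.continuous_monodromy_ofPath w)).inter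
      (hW.preimage (hq.continuous_monodromy_ofPath (f w))))
    ⟨show (hp.monodromy w (.mk α)).1 ∈ V from hαw.symm ▸ hyV,
      show (hq.monodromy (f w) (.mk α)).1 ∈ W by rwa [← hfw]⟩
  replace hyN : p y ∈ N := by rwa [PathsFrom.ofPath_one] at hyN
  filter_upwards [hV.mem_nhds hyV, (hN.preimage p.continuous).mem_nhds hyN] with z hzV hzN
  obtain ⟨β, ⟨hβV, hβW⟩, hβ1⟩ := h _ hzN
  -- Both points lie in `V`, where `p` is injective, and over the same point of `X`.
  have hz : (hp.monodromy w (.mk β.toPath)).1 = z :=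
    hinj hβV hzV ((hp.monodromy w (.mk β.toPath)).2.trans hβ1)
  rw [← hz, hmk]
  exact hβW

end IsSemicovering

theorem fibreFunctor_faithful {X : Type u} [TopologicalSpace X] (hX : IsLocallyWepConnected X)
    (x₀ : X) : (fibreFunctor x₀).Faithful where
  map_injective {p q} f g hfg := by
    refine SCov.Hom.ext (ContinuousMap.ext fun y => ?_)
    obtain ⟨α, -⟩ := hX.exists_path x₀ (p.proj y)
    set a := Path.Homotopic.Quotient.mk α
    have hp := p.isSemicovering
    have hq := q.isSemicovering
    set w := hp.monodromy (⟨y, rfl⟩ : p.proj ⁻¹' {p.proj y}) a.symm with hwdef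
    have hw : (hp.monodromy w a).1 = y := congrArg Subtype.val (hp.monodromy_symm_trans _ a)
    have hfw := congrFun (congrArg RightGSet.Hom.toFun hfg) w
    rw [← hw, hp.map_monodromy hq f.toMap f.comm, hp.map_monodromy hq g.toMap g.comm]
    exact congrArg (fun v => (hq.monodromy v a).1) hfw

theorem fibreFunctor_full {X : Type u} [TopologicalSpace X] (hX : IsLocallyWepConnected X)
    (x₀ : X) : (fibreFunctor x₀).Full where
  map_surjective {p q} f := by
    have hp := p.isSemicovering
    have hq := q.isSemicovering
    refine ⟨⟨⟨hp.extend hX hq f.toFun, hp.continuous_extend hX hq f.toFun f.map_act⟩,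
      fun y => hp.proj_extend hX hq f.toFun y⟩, RightGSet.Hom.ext (funext fun w => ?_)⟩
    refine Subtype.ext ?_
    have h := hp.extend_monodromy hX hq f.toFun f.map_act w (Path.Homotopic.Quotient.refl x₀)
    have h₁ := congrArg Subtype.val (hp.monodromy_refl w)
    have h₂ := congrArg Subtype.val (hq.monodromy_refl (f.toFun w))
    exact (congrArg _ h₁.symm).trans (h.trans h₂)

/-! ### The semicovering associated with a right `π₁`-set -/

/-- The identity of `G` factors through the inclusion of generators and the multiplication of
letters, both continuous. -/
theorem le_tauTopology (G : Type u) [Group G] (t : TopologicalSpace G) : t ≤ tauTopology G t := by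
  have h₁ : TopologicalSpace.coinduced FreeGroup.of t ≤ (markovTopology G t).toTopologicalSpace :=
    continuous_iff_coinduced_le.1 (GroupTopology.coinduced_continuous _)
  have h₂ := coinduced_mono (f := FreeGroup.lift (id : G → G)) h₁
  have h₃ : FreeGroup.lift (id : G → G) ∘ FreeGroup.of = id := by
    funext g; simp
  rwa [coinduced_compose, h₃, coinduced_id] at h₂

namespace RightGSet

theorem isOpen_act_eq {G : Type u} [Group G] [TopologicalSpace G] (F : RightGSet G)
    (z z' : F.carrier) : IsOpen {g | F.act z g = z'} := by
  let _ : TopologicalSpace F.carrier := ⊥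
  have : DiscreteTopology F.carrier := ⟨rfl⟩
  have h : Continuous fun g => F.act z g := F.continuous_act.comp (Continuous.prodMk_right z)
  exact (isOpen_discrete {z'}).preimage h

variable {X : Type u} [TopologicalSpace X] {x₀ : X} (F : RightGSet (PiOne X x₀))

theorem act_trans (z : F.carrier) (a b : Path.Homotopic.Quotient x₀ x₀) :
    F.act z (a.trans b) = F.act (F.act z a) b :=
  F.act_mul z a b

theorem act_refl (z : F.carrier) : F.act z (Path.Homotopic.Quotient.refl x₀) = z :=
  F.act_one z

theorem act_trans_symm (z : F.carrier) {x : X} (a b c : Path.Homotopic.Quotient x₀ x) :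
    F.act (F.act z (a.trans b.symm)) (b.trans c.symm) = F.act z (a.trans c.symm) := by
  rw [← act_trans, Path.Homotopic.Quotient.trans_assoc, ← Path.Homotopic.Quotient.trans_assoc b.symm,
    Path.Homotopic.Quotient.symm_trans, Path.Homotopic.Quotient.refl_trans]

theorem act_trans_symm_self (z : F.carrier) {x : X} (a : Path.Homotopic.Quotient x₀ x) :
    F.act z (a.trans a.symm) = z := by
  rw [Path.Homotopic.Quotient.trans_symm, act_refl]

theorem isOpen_act_mk_eq (z z' : F.carrier) :
    IsOpen {γ : Path x₀ x₀ | F.act z (PiOne.mk γ) = z'} := by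
  exact le_tauTopology _ (PiOne.qtop X x₀) _ (F.isOpen_act_eq z z')

/-- Pairs `(z, γ)` and `(z', γ')` with `γ(1) = γ'(1)` are identified if `z · [γ * γ'⁻¹] = z'`. -/
def totalSetoid : Setoid (F.carrier × PathsFrom x₀) where
  r a b := ∃ h : a.2.1 1 = b.2.1 1, F.act a.1 (PiOne.mk (a.2.loop b.2 h)) = b.1
  iseqv := by
    refine ⟨fun ⟨z, γ⟩ => ⟨rfl, ?_⟩, ?_, ?_⟩
    · obtain ⟨x, α, rfl⟩ := PathsFrom.exists_ofPath' γ
      rw [PathsFrom.loop_ofPath, act_trans_symm_self]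
    · rintro ⟨z, γ⟩ ⟨z', γ'⟩ ⟨h, hz⟩
      obtain ⟨x, β, rfl⟩ := PathsFrom.exists_ofPath' γ'
      obtain ⟨α, rfl⟩ := PathsFrom.exists_ofPath (h.trans (PathsFrom.ofPath_one β))
      refine ⟨h.symm, ?_⟩
      dsimp only at hz ⊢
      rw [PathsFrom.loop_ofPath] at hz ⊢
      rw [← hz, act_trans_symm, act_trans_symm_self]
    · rintro ⟨z, γ⟩ ⟨z', γ'⟩ ⟨z'', γ''⟩ ⟨h, hz⟩ ⟨h', hz'⟩
      obtain ⟨x, γ'', rfl⟩ := PathsFrom.exists_ofPath' γ''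
      have e := h'.trans (PathsFrom.ofPath_one γ'')
      obtain ⟨γ, rfl⟩ := PathsFrom.exists_ofPath (h.trans e)
      obtain ⟨γ', rfl⟩ := PathsFrom.exists_ofPath e
      refine ⟨h.trans h', ?_⟩
      dsimp only at hz hz' ⊢
      rw [PathsFrom.loop_ofPath] at hz hz' ⊢
      rw [← hz', ← hz, act_trans_symm]

/-- The total space `F ×_{π₁} 𝒫_{x₀}X` of the semicovering associated with `F`. -/
def Total : Type u := Quotient F.totalSetoid

namespace Total

variable {F}

/-- The class of the pair `(z, γ)`. -/
def mk (z : F.carrier) (γ : PathsFrom x₀) : Total F := Quotient.mk F.totalSetoid (z, γ)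

theorem mk_eq_mk {z z' : F.carrier} {γ γ' : PathsFrom x₀} :
    mk z γ = mk z' γ' ↔
      ∃ h : γ.1 1 = γ'.1 1, F.act z (PiOne.mk (γ.loop γ' h)) = z' :=
  Quotient.eq (r := F.totalSetoid)

theorem mk_ofPath_eq {z z' : F.carrier} {x : X} {α β : Path x₀ x} :
    mk z (.ofPath α) = mk z' (.ofPath β) ↔
      F.act z ((Path.Homotopic.Quotient.mk α).trans (Path.Homotopic.Quotient.mk β).symm) = z' := by
  rw [mk_eq_mk, exists_prop_of_true ((PathsFrom.ofPath_one α).trans (PathsFrom.ofPath_one β).symm),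
    PathsFrom.loop_ofPath]

theorem mk_injective (γ : PathsFrom x₀) : Function.Injective fun z : F.carrier => mk z γ := by
  intro z z' h
  obtain ⟨x, α, rfl⟩ := PathsFrom.exists_ofPath' γ
  rw [← mk_ofPath_eq.1 h, act_trans_symm_self]

/-- The topology coinduced from `F × 𝒫_{x₀}X`, with `F` discrete. -/
instance : TopologicalSpace (Total F) :=
  ⨆ z : F.carrier, TopologicalSpace.coinduced (mk z) inferInstance

theorem isOpen_iff {s : Set (Total F)} : IsOpen s ↔ ∀ z, IsOpen (mk z ⁻¹' s) := by
  rw [isOpen_iSup_iff]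
  rfl

theorem continuous_mk (z : F.carrier) : Continuous (mk z) :=
  continuous_def.2 fun _ hs => isOpen_iff.1 hs z

variable (F) in
/-- The endpoint projection. -/
def proj : C(Total F, X) where
  toFun := Quotient.lift (s := F.totalSetoid) (fun q => q.2.1 1) fun _ _ h => h.1
  continuous_toFun := by
    refine continuous_def.2 fun s hs => isOpen_iff.2 fun z => ?_
    exact hs.preimage ((continuous_eval_const (1 : unitInterval)).comp continuous_subtype_val)

/-- Since `[z, β] = [z · [β * α⁻¹], α]`, the representing path may be any path with the right
endpoint, in particular a locally well-ended one. -/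
theorem exists_mk_eq (y : Total F) {γ : PathsFrom x₀} (h : γ.1 1 = proj F y) :
    ∃ z, mk z γ = y := by
  induction y using Quotient.inductionOn with | _ q =>
  obtain ⟨z, β⟩ := q
  obtain ⟨x, β, rfl⟩ := PathsFrom.exists_ofPath' β
  obtain ⟨α, rfl⟩ := PathsFrom.exists_ofPath (h.trans (PathsFrom.ofPath_one β))
  exact ⟨_, (mk_ofPath_eq (z := z) (α := β).2 rfl).symm⟩

/-- The loops carrying `z` to `z'` form an open set; its preimage under `loop` contains the trace of
a product neighbourhood. -/
theorem exists_isOpen_of_mk_eq {z z' : F.carrier} {γ γ' : PathsFrom x₀} (h : mk z γ = mk z' γ') :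
    ∃ U U' : Set (PathsFrom x₀), IsOpen U ∧ IsOpen U' ∧ γ ∈ U ∧ γ' ∈ U' ∧
      ∀ β ∈ U, ∀ β' ∈ U', β.1 1 = β'.1 1 → mk z β = mk z' β' := by
  obtain ⟨h1, hz⟩ := mk_eq_mk.1 h
  obtain ⟨O, hO, hOeq⟩ := isOpen_induced_iff.1
    ((F.isOpen_act_mk_eq z z').preimage PathsFrom.continuous_loop)
  have hmem : (γ, γ') ∈ O := by
    have : (⟨(γ, γ'), h1⟩ : {q : PathsFrom x₀ × PathsFrom x₀ // q.1.1 1 = q.2.1 1}) ∈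
        Subtype.val ⁻¹' O := by
      rw [hOeq]; exact hz
    exact this
  obtain ⟨U, U', hU, hU', hm, hm', hsub⟩ := isOpen_prod_iff.1 hO _ _ hmem
  refine ⟨U, U', hU, hU', hm, hm', fun β hβ β' hβ' e => mk_eq_mk.2 ⟨e, ?_⟩⟩
  have : (⟨(β, β'), e⟩ : {q : PathsFrom x₀ × PathsFrom x₀ // q.1.1 1 = q.2.1 1}) ∈
      Subtype.val ⁻¹' O := hsub ⟨hβ, hβ'⟩
  rw [hOeq] at this
  exact this

theorem exists_isOpen_of_end_eq (z : F.carrier) (γ : PathsFrom x₀) :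
    ∃ U : Set (PathsFrom x₀), IsOpen U ∧ γ ∈ U ∧
      ∀ β ∈ U, ∀ β' ∈ U, β.1 1 = β'.1 1 → mk z β = mk z β' := by
  obtain ⟨U, U', hU, hU', hm, hm', h⟩ := exists_isOpen_of_mk_eq (rfl : mk z γ = mk z γ)
  exact ⟨U ∩ U', hU.inter hU', ⟨hm, hm'⟩, fun β hβ β' hβ' => h β hβ.1 β' hβ'.2⟩

/-- A point of the sheet is `[z, β]` with `β ∈ U` well-ended. If it is also `[z₁, γ]`, any `δ` near
`γ` ends where some path of `U` near `β` ends, and the two classes agree. This is where well-ended,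
rather than arbitrary, connecting paths are needed. -/
theorem isOpen_section {z : F.carrier} {U : Set (PathsFrom x₀)} (hU : IsOpen U)
    (hsec : ∀ β ∈ U, ∀ β' ∈ U, β.1 1 = β'.1 1 → mk z β = mk z β') {V : Set X} (hV : IsOpen V)
    (hVU : ∀ b ∈ V, ∃ β ∈ U, IsWellEnded β.1 ∧ β.1 1 = b) :
    IsOpen {w | proj F w ∈ V ∧ ∃ β ∈ U, mk z β = w} := by
  refine isOpen_iff.2 fun z₁ => isOpen_iff_forall_mem_open.2 ?_
  rintro γ ⟨hγV, β₀, hβ₀, hβ₀γ⟩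
  obtain ⟨β, hβ, hw, hβγ⟩ := hVU _ hγV
  have hmk : mk z β = mk z₁ γ :=
    (hsec β hβ β₀ hβ₀ (hβγ.trans (congrArg (proj F) hβ₀γ).symm)).trans hβ₀γ
  obtain ⟨A, B, hA, hB, hmA, hmB, hAB⟩ := exists_isOpen_of_mk_eq hmk
  obtain ⟨W, hW, hmW, hWU⟩ := hw.exists_isOpen (hU.inter hA) ⟨hβ, hmA⟩
  have hend : Continuous fun γ : PathsFrom x₀ => γ.1 1 :=
    (continuous_eval_const (1 : unitInterval)).comp continuous_subtype_val
  refine ⟨B ∩ {δ | δ.1 1 ∈ V ∩ W}, ?_, hB.inter ((hV.inter hW).preimage hend),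
    hmB, hγV, ?_⟩
  · rintro δ ⟨hδB, hδV, hδW⟩
    obtain ⟨η, ⟨hηU, hηA⟩, hη⟩ := hWU _ hδW
    exact ⟨hδV, η, hηU, hAB η hηA δ hδB hη⟩
  · rw [hβγ] at hmW
    exact hmW

/-! ### The projection is a separated local homeomorphism -/

variable (hX : IsLocallyWepConnected X)

include hX

theorem exists_isLocallyWellEnded_mk_eq (y : Total F) :
    ∃ (γ : PathsFrom x₀) (z : F.carrier), IsLocallyWellEnded γ.1 ∧ mk z γ = y := by
  obtain ⟨α, hα⟩ := hX.exists_path x₀ (proj F y)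
  obtain ⟨z, hz⟩ := exists_mk_eq y (PathsFrom.ofPath_one α)
  exact ⟨_, z, hα, hz⟩

theorem isOpenMap_proj : IsOpenMap (proj F) := by
  intro O hO
  rw [isOpen_iff_forall_mem_open]
  rintro _ ⟨y, hy, rfl⟩
  obtain ⟨α, z, hα, rfl⟩ := exists_isLocallyWellEnded_mk_eq hX y
  obtain ⟨V, hV, hm, h⟩ := hα.isWellEnded.exists_isOpen (isOpen_iff.1 hO z) hy
  refine ⟨V, fun b hb => ?_, hV, hm⟩
  obtain ⟨β, hβ, rfl⟩ := h b hb
  exact ⟨mk z β, hβ, rfl⟩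

theorem isLocallyInjective_proj : IsLocallyInjective (proj F) := by
  intro y
  obtain ⟨α, z, hα, rfl⟩ := exists_isLocallyWellEnded_mk_eq hX y
  obtain ⟨U, hU, hm, hsec⟩ := exists_isOpen_of_end_eq z α
  obtain ⟨V, hV, hmV, h⟩ := hα.exists_isOpen hU hm
  refine ⟨_, isOpen_section hU hsec hV h, ⟨hmV, α, hm, rfl⟩, ?_⟩
  rintro _ ⟨-, β, hβ, rfl⟩ _ ⟨-, β', hβ', rfl⟩ h
  exact hsec β hβ β' hβ' h

/-- Two points of one fibre are `[z, α]` and `[z', α]` for the same `α`. If their sheets over a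
common `V` met, then `[z, β] = [z', β]` for some `β`, forcing `z = z'`. -/
theorem isSeparatedMap_proj : IsSeparatedMap (proj F) := by
  intro y y' hyy' hne
  obtain ⟨α, z, hα, rfl⟩ := exists_isLocallyWellEnded_mk_eq hX y
  obtain ⟨z', rfl⟩ := exists_mk_eq (γ := α) y' hyy'
  obtain ⟨U, hU, hm, hsec⟩ := exists_isOpen_of_end_eq z α
  obtain ⟨U', hU', hm', hsec'⟩ := exists_isOpen_of_end_eq z' α
  obtain ⟨V, hV, hmV, h⟩ := hα.exists_isOpen (hU.inter hU') ⟨hm, hm'⟩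
  refine ⟨_, _, isOpen_section (hU.inter hU') (fun β hβ β' hβ' => hsec β hβ.1 β' hβ'.1) hV h,
    isOpen_section (hU.inter hU') (fun β hβ β' hβ' => hsec' β hβ.2 β' hβ'.2) hV h,
    ⟨hmV, α, ⟨hm, hm'⟩, rfl⟩, ⟨hmV, α, ⟨hm, hm'⟩, rfl⟩, Set.disjoint_left.2 ?_⟩
  rintro _ ⟨-, β, hβ, rfl⟩ ⟨-, β', hβ', hββ'⟩
  have e : mk z' β = mk z β :=
    (hsec' β hβ.2 β' hβ'.2 (congrArg (proj F) hββ').symm).trans hββ'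
  exact hne (by rw [mk_injective β e])

theorem isLocalHomeomorph_proj : IsLocalHomeomorph (proj F) := by
  refine isLocalHomeomorph_iff_isOpenEmbedding_restrict.2 fun y => ?_
  obtain ⟨U, hU, hy, hinj⟩ := isLocallyInjective_proj hX y
  exact ⟨U, hU.mem_nhds hy, .of_continuous_injective_isOpenMap
    ((proj F).continuous.comp continuous_subtype_val) (Set.injOn_iff_injective.1 hinj)
    ((isOpenMap_proj hX).comp hU.isOpenMap_subtype_val)⟩

/-! ### Lifting of paths and homotopies -/

/-- Uniqueness of lifts along a contraction `h` of the domain. -/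
theorem eq_of_contraction {D : Type*} [TopologicalSpace D] (h : C(D × unitInterval, D))
    (h1 : ∀ d, h (d, 1) = d) {δ δ' : C(D, Total F)} (h0 : ∀ d, δ (h (d, 0)) = δ' (h (d, 0)))
    (hp : (proj F).comp δ = (proj F).comp δ') : δ = δ' := by
  ext d
  have hc : Continuous fun u => h (d, u) := by fun_prop
  -- Along the track of `d`, two lifts agreeing at time `0` agree on the connected interval; at time
  -- `1` the track is at `d`.
  have := (isSeparatedMap_proj hX).eq_of_comp_eq (isLocallyInjective_proj hX)
    (δ.continuous.comp hc) (δ'.continuous.comp hc)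
    (funext fun u => DFunLike.congr_fun hp (h (d, u))) 0 (h0 d)
  simpa [h1] using congrFun this 1

omit hX in
/-- Continuous lifting of families of maps along a contraction `h` of the domain. -/
theorem exists_continuous_lift {D Φ : Type*} [TopologicalSpace D] [LocallyCompactSpace D]
    [TopologicalSpace Φ] (h : C(D × unitInterval, D)) (h1 : ∀ d, h (d, 1) = d) (y : Total F)
    (i : C(Φ, C(D, X))) (hi : ∀ φ d, i φ (h (d, 0)) = proj F y) :
    ∃ L : C(Φ, C(D, Total F)), (∀ φ d, proj F (L φ d) = i φ d) ∧
      ∀ φ d, (∀ u, h (d, u) = d) → L φ d = y := by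
  induction y using Quotient.inductionOn with | _ q =>
  obtain ⟨z, γ⟩ := q
  let c (q : Φ × D) : Path (γ.1 1) (i q.1 q.2) :=
    { toFun := fun u => i q.1 (h (q.2, u))
      source' := hi q.1 q.2
      target' := congrArg _ (h1 q.2) }
  -- Local compactness of `D` makes evaluation jointly continuous.
  have hc : Continuous ↿c := by
    change Continuous fun r : (Φ × D) × unitInterval => i r.1.1 (h (r.1.2, r.2))
    fun_prop
  have hcont : Continuous fun q => mk z (.ofPath (γ.toPath.trans (c q))) := by
    refine (continuous_mk z).comp (PathsFrom.continuous_ofPath _ ?_)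
    refine Path.trans_continuous_family (ι := Φ × D) (fun _ => γ.toPath) ?_ c hc
    change Continuous fun r : (Φ × D) × unitInterval => γ.toPath r.2
    fun_prop
  refine ⟨ContinuousMap.curry ⟨_, hcont⟩, fun φ d => PathsFrom.ofPath_one (γ.toPath.trans (c (φ, d))),
    fun φ d hd => ?_⟩
  change mk z (.ofPath (γ.toPath.trans (c (φ, d)))) = mk z (.ofPath γ.toPath)
  have e : γ.1 1 = i φ d := (hi φ d).symm.trans (by rw [hd])
  have hcd : c (φ, d) = (Path.refl (γ.1 1)).cast rfl e.symm := by
    ext u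
    change i φ (h (d, u)) = γ.1 1
    rw [hd, e]
  rw [hcd]
  -- `ofPath` forgets the endpoint, so the cast disappears by definition.
  have : PathsFrom.ofPath (γ.toPath.trans ((Path.refl (γ.1 1)).cast rfl e.symm)) =
      PathsFrom.ofPath (γ.toPath.trans (Path.refl (γ.1 1))) := rfl
  rw [this, mk_ofPath_eq, Path.Homotopic.Quotient.mk_trans, Path.Homotopic.Quotient.mk_refl,
    Path.Homotopic.Quotient.trans_refl, act_trans_symm_self]

theorem isHomeomorph_pathsFrom_map (y : Total F) : IsHomeomorph (PathsFrom.map (proj F) y) := by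
  let h : C(unitInterval × unitInterval, unitInterval) := ⟨fun q => q.1 * q.2, by fun_prop⟩
  have h0 (d) : h (d, 0) = 0 := mul_zero d
  have h1 (d) : h (d, 1) = d := mul_one d
  obtain ⟨L, hL, hLy⟩ := exists_continuous_lift (Φ := PathsFrom (proj F y)) h h1 y
    ⟨Subtype.val, continuous_subtype_val⟩ fun φ d => by rw [h0]; exact φ.2
  have hLi (φ) : (proj F).comp (L φ) = φ.1 := ContinuousMap.ext (hL φ)
  have hLy' (φ) : L φ 0 = y := hLy φ 0 fun u => zero_mul u
  exact Homeomorph.isHomeomorph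
    { toFun := PathsFrom.map (proj F) y
      invFun := fun φ => ⟨L φ, hLy' φ⟩
      left_inv := fun δ => Subtype.ext <| eq_of_contraction hX h h1
        (fun d => by rw [h0]; exact (hLy' _).trans δ.2.symm) (hLi _)
      right_inv := fun φ => Subtype.ext (hLi φ)
      continuous_toFun := Continuous.subtype_mk
        ((ContinuousMap.continuous_postcomp _).comp continuous_subtype_val) _
      continuous_invFun := Continuous.subtype_mk L.continuous _ }

theorem isHomeomorph_homotopiesFrom_map (y : Total F) :
    IsHomeomorph (HomotopiesFrom.map (proj F) y) := by
  -- Scaling `s` contracts the triangle onto the edge `s = 0`, fixing that edge pointwise, so the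
  -- lifts are constantly `y` there.
  let h : C(TriangleDomain × unitInterval, TriangleDomain) :=
    ⟨fun q => ⟨(q.1.1.1 * q.2, q.1.1.2), by
      have := mul_le_of_le_one_right q.1.1.1.2.1 q.2.2.2
      have := q.1.2
      push_cast
      linarith⟩, by fun_prop⟩
  have h0 (d) : (h (d, 0)).1.1 = 0 := mul_zero d.1.1
  have h1 (d) : h (d, 1) = d := Subtype.ext (Prod.ext (mul_one d.1.1) rfl)
  have : CompactSpace TriangleDomain := isCompact_iff_compactSpace.1 <| IsClosed.isCompact <|
    isClosed_le (f := fun z : unitInterval × unitInterval => (z.1 : ℝ) + (z.2 : ℝ)) (by fun_prop)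
      continuous_const
  obtain ⟨L, hL, hLy⟩ := exists_continuous_lift (Φ := HomotopiesFrom (proj F y)) h h1 y
    ⟨Subtype.val, continuous_subtype_val⟩ fun φ d => φ.2 _ (h0 d)
  have hLi (φ) : (proj F).comp (L φ) = φ.1 := ContinuousMap.ext (hL φ)
  have hLy' (φ) (d : TriangleDomain) (hd : d.1.1 = 0) : L φ d = y := hLy φ d fun u =>
    Subtype.ext (Prod.ext (show d.1.1 * u = d.1.1 by rw [hd, zero_mul]) rfl)
  exact Homeomorph.isHomeomorph
    { toFun := HomotopiesFrom.map (proj F) y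
      invFun := fun φ => ⟨L φ, hLy' φ⟩
      left_inv := fun δ => Subtype.ext <| eq_of_contraction hX h h1
        (fun d => (hLy' _ _ (h0 d)).trans (δ.2 _ (h0 d)).symm) (hLi _)
      right_inv := fun φ => Subtype.ext (hLi φ)
      continuous_toFun := Continuous.subtype_mk
        ((ContinuousMap.continuous_postcomp _).comp continuous_subtype_val) _
      continuous_invFun := Continuous.subtype_mk L.continuous _ }

theorem isSemicovering_proj : IsSemicovering (proj F) where
  isLocalHomeomorph := isLocalHomeomorph_proj hX
  paths := isHomeomorph_pathsFrom_map hX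
  homotopies := isHomeomorph_homotopiesFrom_map hX

/-- The lift of `γ` is `t ↦ [z, γ_t]` with `γ_t(u) = γ(tu)`; it ends at `[z, γ] = [z · [γ], const]`.
-/
theorem monodromy_mk_refl (z : F.carrier) (g : PiOne X x₀) :
    ((isSemicovering_proj hX).monodromy
      (⟨mk z (.ofPath (Path.refl x₀)), rfl⟩ : proj F ⁻¹' {x₀}) g).1 =
      mk (F.act z g) (.ofPath (Path.refl x₀)) := by
  induction g using Path.Homotopic.Quotient.ind with | _ γ =>
  let c (t : unitInterval) : Path x₀ (γ t) :=
    { toFun := fun u => γ (t * u)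
      source' := by simp
      target' := by simp }
  have hc : Continuous fun t => mk z (.ofPath (c t)) := by
    refine (continuous_mk z).comp (PathsFrom.continuous_ofPath _ ?_)
    change Continuous fun r : unitInterval × unitInterval => γ (r.1 * r.2)
    fun_prop
  rw [IsSemicovering.monodromy_mk, IsSemicovering.liftPath_eq _ _ γ (δ := ⟨_, hc⟩) ?_
    fun t => PathsFrom.ofPath_one (c t)]
  · have hc1 : PathsFrom.ofPath (c 1) = PathsFrom.ofPath γ := by
      refine Subtype.ext (ContinuousMap.ext fun u => ?_)
      change γ (1 * u) = γ u
      rw [one_mul]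
    change mk z (.ofPath (c 1)) = _
    rw [hc1, mk_ofPath_eq, ← Path.Homotopic.Quotient.mk_symm, Path.refl_symm,
      Path.Homotopic.Quotient.mk_refl, Path.Homotopic.Quotient.trans_refl]
  · change mk z (.ofPath (c 0)) = mk z (.ofPath (Path.refl x₀))
    congr 1
    refine Subtype.ext (ContinuousMap.ext fun u => ?_)
    change γ (0 * u) = x₀
    rw [zero_mul, γ.source]

end Total
end RightGSet

/-! ### Transitive right `G`-sets and coset spaces -/

namespace RightGSet

variable {G : Type u} [Group G] [TopologicalSpace G]

/-- A bijective `G`-map is an isomorphism. -/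
noncomputable def isoOfBijective {F F' : RightGSet G} (f : F ⟶ F')
    (hf : Function.Bijective (Hom.toFun f)) : F ≅ F' where
  hom := f
  inv :=
    { toFun := (Equiv.ofBijective _ hf).symm
      map_act := fun y g => by
        rw [Equiv.symm_apply_eq, Equiv.ofBijective_apply, Hom.map_act,
          ← Equiv.ofBijective_apply f.toFun (hf := hf), Equiv.apply_symm_apply] }
  hom_inv_id := Hom.ext (funext (Equiv.ofBijective _ hf).symm_apply_apply)
  inv_hom_id := Hom.ext (funext (Equiv.ofBijective _ hf).apply_symm_apply)

theorem isTransitive_of_iso {F F' : RightGSet G} (e : F ≅ F') (h : isTransitive G F) :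
    isTransitive G F' := by
  obtain ⟨x, hx⟩ := h
  refine ⟨e.hom.toFun x, fun y => ?_⟩
  obtain ⟨g, hg⟩ := hx (e.inv.toFun y)
  refine ⟨g, ?_⟩
  rw [← e.hom.map_act, hg]
  exact congrFun (congrArg Hom.toFun e.inv_hom_id) y

/-- The stabilizer of a point of a right `G`-set. -/
def stabilizer (F : RightGSet G) (x : F.carrier) : OpenSubgroup G where
  carrier := {g | F.act x g = x}
  mul_mem' {a b} ha hb := by
    rw [Set.mem_ofPred_eq] at *
    rw [F.act_mul, ha, hb]
  one_mem' := F.act_one x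
  inv_mem' {a} ha := by
    rw [Set.mem_ofPred_eq] at *
    conv_lhs => rw [← ha]
    rw [← F.act_mul, mul_inv_cancel, F.act_one]
  isOpen' := F.isOpen_act_eq x x

variable [IsTopologicalGroup G]

theorem isTransitive_coset (H : OpenSubgroup G) : isTransitive G (coset H) := by
  refine ⟨Quotient.mk'' 1, fun y => ?_⟩
  induction y using Quotient.inductionOn' with | _ g =>
  refine ⟨g, ?_⟩
  change Quotient.mk'' (1 * g) = _
  rw [one_mul]

/-- The orbit map `H \ G → F` of a point `x` with stabilizer `H`. -/
def orbitMap (F : RightGSet G) (x : F.carrier) : coset (F.stabilizer x) ⟶ F where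
  toFun := Quotient.lift (s := QuotientGroup.rightRel _) (F.act x) fun a b h => by
    have h' : F.act x (b * a⁻¹) = x := QuotientGroup.rightRel_apply.1 h
    conv_lhs => rw [← h']
    rw [← F.act_mul, inv_mul_cancel_right]
  map_act y g := by
    induction y using Quotient.inductionOn' with | _ a =>
    exact F.act_mul x a g

theorem bijective_orbitMap {F : RightGSet G} {x : F.carrier} (hx : ∀ y, ∃ g, F.act x g = y) :
    Function.Bijective (Hom.toFun (F.orbitMap x)) := by
  constructor
  · intro y z h
    induction y using Quotient.inductionOn' with | _ a =>
    induction z using Quotient.inductionOn' with | _ b =>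
    refine Quotient.sound' (QuotientGroup.rightRel_apply.2 ?_)
    change F.act x a = F.act x b at h
    change F.act x (b * a⁻¹) = x
    rw [F.act_mul, ← h, ← F.act_mul, mul_inv_cancel, F.act_one]
  · intro y
    obtain ⟨g, hg⟩ := hx y
    exact ⟨Quotient.mk'' g, hg⟩

theorem isTransitive_iff (F : RightGSet G) :
    isTransitive G F ↔ ∃ H : OpenSubgroup G, Nonempty (F ≅ coset H) := by
  constructor
  · rintro ⟨x, hx⟩
    exact ⟨F.stabilizer x, ⟨(isoOfBijective _ (bijective_orbitMap hx)).symm⟩⟩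
  · rintro ⟨H, ⟨e⟩⟩
    exact isTransitive_of_iso e.symm (isTransitive_coset H)

end RightGSet

/-! ### The equivalence and its connected part -/

section Classification

variable {X : Type u} [TopologicalSpace X]

/-- The semicovering associated with a right `π₁(X, x₀)`-set. -/
def RightGSet.toSCov (hX : IsLocallyWepConnected X) {x₀ : X} (F : RightGSet (PiOne X x₀)) :
    SCov X where
  space := F.Total
  proj := Total.proj F
  isSemicovering := Total.isSemicovering_proj hX

/-- The canonical map from `F` to the fibre of its associated semicovering. -/
def RightGSet.toFibre (hX : IsLocallyWepConnected X) {x₀ : X} (F : RightGSet (PiOne X x₀)) :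
    F ⟶ (F.toSCov hX).fibre x₀ where
  toFun z := ⟨Total.mk z (.ofPath (Path.refl x₀)), rfl⟩
  map_act z g := Subtype.ext (Total.monodromy_mk_refl hX z g).symm

theorem RightGSet.bijective_toFibre (hX : IsLocallyWepConnected X) {x₀ : X}
    (F : RightGSet (PiOne X x₀)) : Function.Bijective (Hom.toFun (F.toFibre hX)) := by
  refine ⟨fun z z' h => Total.mk_injective _ (congrArg Subtype.val h), fun y => ?_⟩
  obtain ⟨z, hz⟩ := Total.exists_mk_eq y.1 (γ := .ofPath (Path.refl x₀)) y.2.symm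
  exact ⟨z, Subtype.ext hz⟩

theorem fibreFunctor_essSurj (hX : IsLocallyWepConnected X) (x₀ : X) :
    (fibreFunctor x₀).EssSurj where
  mem_essImage F := ⟨F.toSCov hX, ⟨(RightGSet.isoOfBijective _ (F.bijective_toFibre hX)).symm⟩⟩

/-- Every point of a semicovering is joined to a point of the fibre over `x₀`. -/
theorem SCov.exists_joined_fibre (hX : IsLocallyWepConnected X) (x₀ : X) (p : SCov X)
    (y : p.space) : ∃ w : p.proj ⁻¹' {x₀}, Joined y w.1 := by
  obtain ⟨α, -⟩ := hX.exists_path (p.proj y) x₀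
  have hp := p.isSemicovering
  exact ⟨hp.monodromy ⟨y, rfl⟩ (.mk α), ⟨⟨hp.liftPath ⟨y, rfl⟩ α, hp.liftPath_zero _ _, rfl⟩⟩⟩

/-- A path between fibre points is the lift of its projection, a loop at `x₀`. -/
theorem SCov.joined_fibre_iff {x₀ : X} (p : SCov X) (w w' : p.proj ⁻¹' {x₀}) :
    Joined w.1 w'.1 ↔ ∃ g : PiOne X x₀, (p.fibre x₀).act w g = w' := by
  have hp := p.isSemicovering
  constructor
  · rintro ⟨δ⟩
    exact ⟨PiOne.mk ((δ.map p.proj.continuous).cast w.2.symm w'.2.symm),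
      Subtype.ext (hp.monodromy_map δ w.2.symm w'.2.symm)⟩
  · rintro ⟨g, rfl⟩
    induction g using Path.Homotopic.Quotient.ind with | _ γ =>
    exact ⟨⟨hp.liftPath w γ, hp.liftPath_zero _ _, rfl⟩⟩

theorem SCov.isTransitive_fibre_iff (hX : IsLocallyWepConnected X) (x₀ : X) (p : SCov X) :
    RightGSet.isTransitive _ (p.fibre x₀) ↔ SCov.isConnected X p := by
  constructor
  · rintro ⟨w, hw⟩
    refine ⟨⟨w.1⟩, ?_⟩
    have h (y : p.space) : Joined w.1 y := by
      obtain ⟨v, hv⟩ := p.exists_joined_fibre hX x₀ y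
      exact ((p.joined_fibre_iff w v).2 (hw v)).trans hv.symm
    exact fun y y' => (h y).symm.trans (h y')
  · intro h
    have : PathConnectedSpace p.space := h
    obtain ⟨y⟩ := this.nonempty
    obtain ⟨w, -⟩ := p.exists_joined_fibre hX x₀ y
    exact ⟨w, fun v => (p.joined_fibre_iff w v).1 (this.joined _ _)⟩

end Classification

theorem mainTheorem4 {X : Type u} [TopologicalSpace X] (hX : IsLocallyWepConnected X) (x₀ : X) :
    (fibreFunctor x₀).IsEquivalence ∧
    (∃ h : ∀ p : SCov₀ X, RightGSet.isTransitive (PiOne X x₀) ((fibreFunctor x₀).obj p.obj),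
      ((RightGSet.isTransitive (PiOne X x₀)).lift
        ((SCov.isConnected X).ι ⋙ fibreFunctor x₀) h : SCov₀ X ⥤ OrbitCategory (PiOne X x₀)
        ).IsEquivalence) ∧
    ∀ F : RightGSet (PiOne X x₀), RightGSet.isTransitive (PiOne X x₀) F ↔
      ∃ H : OpenSubgroup (PiOne X x₀), Nonempty (F ≅ RightGSet.coset H) := by
  have := fibreFunctor_faithful hX x₀
  have := fibreFunctor_full hX x₀
  have := fibreFunctor_essSurj hX x₀
  refine ⟨{}, ⟨fun p => (p.obj.isTransitive_fibre_iff hX x₀).2 p.property, ?_⟩,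
    RightGSet.isTransitive_iff⟩
  have : ((SCov.isConnected X).ι ⋙ fibreFunctor x₀).Faithful := Functor.Faithful.comp _ _
  have : ((SCov.isConnected X).ι ⋙ fibreFunctor x₀).Full := Functor.Full.comp _ _
  refine
    { faithful := ObjectProperty.instFaithfulFullSubcategoryLift _ _ _
      full := ObjectProperty.instFullFullSubcategoryLift _ _ _
      essSurj := ⟨fun F => ?_⟩ }
  -- Any semicovering whose fibre is isomorphic to a transitive set is connected, so the preimage
  -- under the full functor suffices.
  let p := (fibreFunctor x₀).objPreimage F.obj
  let e : (fibreFunctor x₀).obj p ≅ F.obj := (fibreFunctor x₀).objObjPreimageIso F.obj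
  have hp : SCov.isConnected X p :=
    (p.isTransitive_fibre_iff hX x₀).1 (RightGSet.isTransitive_of_iso e.symm F.property)
  exact ⟨⟨p, hp⟩, ⟨ObjectProperty.isoMk _ e⟩⟩
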